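/- Let $n \ge 1$, let $\lambda$ be a partition of $n$ with exactly $m_i$ parts equal to $i$ ($1 \le i \le n$), and let $\mathcal{C}_\lambda$ be the conjugacy class of $S_n$ consisting of the permutations with cycle type $\lambda$ (fixed points are counted as parts equal to $1$). For $\pi \in S_n$ let $d(\pi) = |\{\, i \in \{1,\dots,n-1\} : \pi(i) > \pi(i+1) \,\}|$ be its number of descents, and let $$A_{\mathcal{C}_\lambda}(t) = \sum_{\pi \in \mathcal{C}_\lambda} t^{\,d(\pi)+1}$$ be the descent generating function of $\mathcal{C}_\lambda$. For $i \ge 1$ and $a \in \mathbb{Z}$ put $f_{i,a} = \frac{1}{i} \sum_{d \mid i} \mu(d)\, a^{i/d}$, where $\mu$ is the Möbius function, and let $\binom{x}{m} = x(x-1)\cdots(x-m+1)/m!$. Then for every complex number $t$ with $|t| > 1$ the following series converges absolutely and $$A_{\mathcal{C}_\lambda}(t) = (t-1)^{n+1} \sum_{a=1}^{\infty} t^{-a} \left[ (-1)^n \prod_{i=1}^{n} \binom{f_{i,-a} + m_i - 1}{m_i} \right].$$ -/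

import Mathlib

open Equiv Finset

noncomputable section

/-- The descent set of `π ∈ Sₙ`: the positions `i` with a successor such that `π(i) > π(i+1)`
(positions are indexed by `0, …, n-1`, so a descent position is one of `0, …, n-2`). -/
def descentSet {n : ℕ} (π : Perm (Fin n)) : Finset (Fin n) :=
  {i : Fin n | ∃ h : (i : ℕ) + 1 < n, π ⟨(i : ℕ) + 1, h⟩ < π i}

/-- The descent number `d(π) = |Des(π)|`. -/
def descentNumber {n : ℕ} (π : Perm (Fin n)) : ℕ := (descentSet π).card

open Classical in
/-- The descent generating function of a set `S` of permutations, in the normalization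
`A_S(t) = ∑_{π ∈ S} t^{d(π)+1}` of the classical Eulerian polynomials
(for which `∑_{a ≥ 1} aⁿ tᵃ = A_{Sₙ}(t) / (1-t)^{n+1}`). -/
def descentGenFun {n : ℕ} (S : Set (Perm (Fin n))) (t : ℂ) : ℂ :=
  ∑ π : Perm (Fin n) with π ∈ S, t ^ (descentNumber π + 1)

/-- `f_{i,a} = (1/i) ∑_{d ∣ i} μ(d) a^{i/d}`, for `i ≥ 1` and any integer `a`. -/
def necklaceNumber (i : ℕ) (a : ℤ) : ℚ :=
  (1 / (i : ℚ)) * ∑ d ∈ i.divisors, (ArithmeticFunction.moebius d : ℚ) * (a : ℚ) ^ (i / d)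

/-- The product `∏_{i=1}^n binom(f_{i,a} + m_i - 1, m_i)`, where `m_i` is the number of parts
of `lam` equal to `i` and `binom(x, m) = x(x-1)⋯(x-m+1)/m!`. -/
def cycleBinomialProduct {n : ℕ} (lam : n.Partition) (a : ℤ) : ℚ :=
  ∏ i ∈ Finset.Icc 1 n,
    Ring.choose (necklaceNumber i a + (lam.parts.count i : ℚ) - 1) (lam.parts.count i)

end

/-!
Call a labelling `s : Fin n → Fin a` sorted for `π` if the pairs `(s x, π x)` increase
lexicographically. Such labellings are weakly increasing sequences which have to increase at the
descents of `π`, so there are `(a + n - 1 - d(π)).choose n` of them. Following Gessel and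
Reutenauer, read off the word of labels along the `π`-orbit of each point: the multiset of the
words obtained is invariant under the shift, determines `(π, s)`, and every shift-invariant
multiset of `n` periodic words arises. A cycle of length `i` contributes the rotations of a
primitive word of length `i`, and there are `f_{i,a}` of these up to rotation. Counting pairs by
cycle type therefore gives
`∑ π ∈ C, (a + n - 1 - d(π)).choose n = ∏ i, (f_{i,a} + m_i - 1).choose m_i`.

Both sides are polynomials in `a`. Replacing `a` by `-a` turns the summand on the left into
`(-1)^n * (a + d(π)).choose n`, and
`∑ a ≥ 1, t^(-a) * (a + d).choose n = t^(d+1) / (t-1)^(n+1)` for `d < n`.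
-/

section BinomialSeries

variable {𝕜 : Type*} [NormedField 𝕜]

theorem hasSum_add_choose_mul_pow {d n : ℕ} (hd : d ≤ n) {r : 𝕜} (hr : ‖r‖ < 1) :
    HasSum (fun a : ℕ => ((a + d).choose n : 𝕜) * r ^ a) (r ^ (n - d) / (1 - r) ^ (n + 1)) := by
  obtain ⟨e, rfl⟩ := Nat.exists_eq_add_of_le hd
  have hvanish : ∀ a ∉ Set.range (· + e), ((a + d).choose (d + e) : 𝕜) * r ^ a = 0 := fun a ha => by
    have hlt : a < e := by
      by_contra! hle
      exact ha ⟨a - e, Nat.sub_add_cancel hle⟩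
    rw [Nat.choose_eq_zero_of_lt (by omega), Nat.cast_zero, zero_mul]
  rw [← (add_left_injective e).hasSum_iff hvanish, Nat.add_sub_cancel_left, div_eq_mul_one_div]
  refine ((hasSum_choose_mul_geometric_of_norm_lt_one (d + e) hr).mul_left (r ^ e)).congr_fun ?_
  intro a
  simp only [Function.comp_apply, add_assoc, add_comm e d, pow_add]
  ring

theorem hasSum_zpow_neg_mul_choose {d n : ℕ} (hd : d < n) {t : 𝕜} (ht : 1 < ‖t‖) :
    HasSum (fun a : ℕ+ => t ^ (-(a : ℤ)) * (((a : ℕ) + d).choose n : 𝕜))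
      (t ^ (d + 1) / (t - 1) ^ (n + 1)) := by
  have ht0 : t ≠ 0 := norm_pos_iff.1 (one_pos.trans ht)
  have ht1 : t - 1 ≠ 0 := sub_ne_zero.2 fun h => by simp [h] at ht
  have hvanish : ∀ a ∉ Set.range ((↑) : ℕ+ → ℕ), ((a + d).choose n : 𝕜) * t⁻¹ ^ a = 0 := by
    intro a ha
    have ha0 : a = 0 := by
      by_contra ha0
      exact ha ⟨⟨a, Nat.pos_of_ne_zero ha0⟩, rfl⟩
    rw [Nat.choose_eq_zero_of_lt (by omega), Nat.cast_zero, zero_mul]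
  have hval : t⁻¹ ^ (n - d) / (1 - t⁻¹) ^ (n + 1) = t ^ (d + 1) / (t - 1) ^ (n + 1) := by
    rw [show 1 - t⁻¹ = (t - 1) / t by field_simp, show n + 1 = (n - d) + (d + 1) by omega,
      div_pow, inv_pow, pow_add t]
    field_simp
  have hr : ‖t⁻¹‖ < 1 := by simpa using inv_lt_one_of_one_lt₀ ht
  rw [← hval]
  refine ((PNat.coe_injective.hasSum_iff hvanish).2
    (hasSum_add_choose_mul_pow hd.le hr)).congr_fun ?_
  intro a
  simp [mul_comm]

end BinomialSeries

noncomputable section PolynomialFunctions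

/-- The algebra of functions on `ℤ` that are given by a polynomial with coefficients in `K`. -/
def intPolynomialFunctions (K : Type*) [CommRing K] : Subalgebra K (ℤ → K) :=
  (Polynomial.aeval fun z : ℤ => (z : K)).range

namespace intPolynomialFunctions

variable {K : Type*}

theorem mem_iff [CommRing K] {f : ℤ → K} :
    f ∈ intPolynomialFunctions K ↔ ∃ P : Polynomial K, ∀ z : ℤ, P.eval (z : K) = f z := by
  simp [intPolynomialFunctions, funext_iff, Polynomial.aeval_fn_apply]

theorem intCast_mem [CommRing K] : (fun z : ℤ => (z : K)) ∈ intPolynomialFunctions K :=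
  mem_iff.2 ⟨Polynomial.X, fun _ => Polynomial.eval_X⟩

theorem const_mem [CommRing K] (c : K) : (fun _ : ℤ => c) ∈ intPolynomialFunctions K :=
  (intPolynomialFunctions K).algebraMap_mem c

theorem fun_sum_mem [CommRing K] {ι : Type*} {s : Finset ι} {f : ι → ℤ → K}
    (hf : ∀ i ∈ s, f i ∈ intPolynomialFunctions K) :
    (fun z => ∑ i ∈ s, f i z) ∈ intPolynomialFunctions K :=
  sum_fn s f ▸ sum_mem hf

theorem fun_prod_mem [CommRing K] {ι : Type*} {s : Finset ι} {f : ι → ℤ → K}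
    (hf : ∀ i ∈ s, f i ∈ intPolynomialFunctions K) :
    (fun z => ∏ i ∈ s, f i z) ∈ intPolynomialFunctions K :=
  prod_fn s f ▸ prod_mem hf

theorem choose_mem [Field K] [CharZero K] {f : ℤ → K} (hf : f ∈ intPolynomialFunctions K) (m : ℕ) :
    (fun z => Ring.choose (f z) m) ∈ intPolynomialFunctions K := by
  obtain ⟨P, hP⟩ := mem_iff.1 hf
  refine mem_iff.2 ⟨Polynomial.C (m.factorial : K)⁻¹ * (descPochhammer K m).comp P, fun z => ?_⟩
  rw [Ring.choose_eq_smul, ← Polynomial.aeval_eq_smeval, smul_eq_mul, Polynomial.eval_C_mul,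
    Polynomial.eval_comp, hP, Polynomial.aeval_def, ← Polynomial.eval_map, algebraMap_int_eq,
    descPochhammer_map]

theorem eq_of_forall_natCast_eq [CommRing K] [IsDomain K] [CharZero K] {f g : ℤ → K}
    (hf : f ∈ intPolynomialFunctions K) (hg : g ∈ intPolynomialFunctions K)
    (h : ∀ a : ℕ, f a = g a) : f = g := by
  obtain ⟨P, hP⟩ := mem_iff.1 hf
  obtain ⟨Q, hQ⟩ := mem_iff.1 hg
  have hPQ : P = Q := by
    refine Polynomial.eq_of_infinite_eval_eq P Q
      ((Set.infinite_range_of_injective (Nat.cast_injective (R := K))).mono ?_)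
    rintro _ ⟨a, rfl⟩
    simpa [← hP, ← hQ] using h a
  funext z
  rw [← hP, ← hQ, hPQ]

end intPolynomialFunctions

end PolynomialFunctions

open Function (minimalPeriod IsPeriodicPt)

section Periods

variable {α β : Type*}

theorem minimalPeriod_eq_of_semiconj {f : α → α} {g : β → β} {φ : α → β}
    (h : Function.Semiconj φ f g) {x : α} (hφ : ∀ k, φ (f^[k] x) = φ x → f^[k] x = x) :
    minimalPeriod g (φ x) = minimalPeriod f x :=
  Function.minimalPeriod_eq_minimalPeriod_iff.2 fun k =>
    ⟨fun hk => hφ k ((h.iterate_right k x).trans hk), fun hk => hk.map h⟩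

theorem minimalPeriod_perm_pos [Finite α] (σ : Perm α) (x : α) : 0 < minimalPeriod σ x :=
  Function.minimalPeriod_pos_of_mem_periodicPts (σ.injective.mem_periodicPts x)

theorem minimalPeriod_eq_card_of_isCycleOn {σ : Perm α} {s : Finset α} (h : σ.IsCycleOn s) {x : α}
    (hx : x ∈ s) : minimalPeriod σ x = #s := by
  refine Nat.dvd_right_iff_eq.mp fun k => ?_
  rw [← Function.isPeriodicPt_iff_minimalPeriod_dvd, ← h.pow_apply_eq hx, IsPeriodicPt,
    Function.IsFixedPt, Perm.iterate_eq_pow]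

variable [Fintype α] [DecidableEq α]

theorem filter_minimalPeriod_eq_biUnion_support (σ : Perm α) {i : ℕ} (hi : i ≠ 1) :
    ({x | minimalPeriod σ x = i} : Finset α) =
      {c ∈ σ.cycleFactorsFinset | #c.support = i}.biUnion Perm.support := by
  ext x
  simp only [mem_filter, mem_univ, true_and, mem_biUnion]
  constructor
  · intro hx
    have hmoved : σ x ≠ x := fun hfix =>
      hi (hx.symm.trans (Function.minimalPeriod_eq_one_iff_isFixedPt.2 hfix))
    have hxc : x ∈ (σ.cycleOf x).support :=
      (Perm.mem_support_cycleOf_iff' hmoved).2 (Perm.SameCycle.refl σ x)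
    exact ⟨σ.cycleOf x,
      ⟨Perm.cycleOf_mem_cycleFactorsFinset_iff.2 (Perm.mem_support.2 hmoved),
        (minimalPeriod_eq_card_of_isCycleOn (σ.isCycleOn_support_cycleOf x) hxc).symm.trans hx⟩,
      hxc⟩
  · rintro ⟨c, ⟨hc, rfl⟩, hx⟩
    exact minimalPeriod_eq_card_of_isCycleOn
      (Perm.isCycleOn_support_of_mem_cycleFactorsFinset hc) hx

theorem card_filter_minimalPeriod_eq_mul_count_cycleType (σ : Perm α) {i : ℕ} (hi : i ≠ 1) :
    #{x | minimalPeriod σ x = i} = i * σ.cycleType.count i := by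
  have hdisj : (σ.cycleFactorsFinset : Set (Perm α)).PairwiseDisjoint Perm.support :=
    fun c hc d hd hcd =>
      (σ.cycleFactorsFinset_pairwise_disjoint hc hd hcd).disjoint_support
  rw [filter_minimalPeriod_eq_biUnion_support σ hi,
    card_biUnion (hdisj.subset (coe_subset.2 (filter_subset _ _))),
    sum_const_nat fun c hc => (mem_filter.1 hc).2, mul_comm, Perm.cycleType_def,
    Multiset.count_map]
  simp only [eq_comm]
  rfl

theorem card_filter_minimalPeriod_eq_mul_count_parts (σ : Perm α) (i : ℕ) :
    #{x | minimalPeriod σ x = i} = i * σ.partition.parts.count i := by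
  rw [Perm.parts_partition, Multiset.count_add, Multiset.count_replicate]
  rcases eq_or_ne i 1 with rfl | hi
  · have hcount : σ.cycleType.count 1 = 0 :=
      Multiset.count_eq_zero.2 fun h => (Perm.two_le_of_mem_cycleType h).not_gt one_lt_two
    have hfix : ({x | minimalPeriod σ x = 1} : Finset α) = σ.supportᶜ := by
      ext x
      simp [Function.minimalPeriod_eq_one_iff_isFixedPt, Function.IsFixedPt]
    rw [hfix, card_compl, hcount, if_pos rfl, zero_add, one_mul]
  · rw [card_filter_minimalPeriod_eq_mul_count_cycleType σ hi, if_neg hi.symm, add_zero]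

end Periods

section Orbits

variable {α β : Type*} {σ : Perm α}

theorem apply_eq_of_sameCycle {c : α → β} (hc : ∀ x, c (σ x) = c x) {x y : α}
    (h : σ.SameCycle x y) : c x = c y := by
  obtain ⟨k, rfl⟩ := h
  induction k with
  | zero => rfl
  | succ k ih => rw [add_comm, zpow_one_add, Perm.mul_apply, hc, ih]
  | pred k ih =>
    rw [ih, sub_eq_neg_add, zpow_add, zpow_neg_one, Perm.mul_apply, ← hc (σ⁻¹ _)]
    simp

theorem isCycleOn_setOf_sameCycle (σ : Perm α) (x : α) : σ.IsCycleOn {y | σ.SameCycle x y} := by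
  refine ⟨⟨fun _ hy => Perm.sameCycle_apply_right.2 hy, σ.injective.injOn, fun y hy => ?_⟩,
    fun _ hy _ hz => hy.symm.trans hz⟩
  exact ⟨σ⁻¹ y, Perm.sameCycle_apply_right.1 (by simpa using hy), by simp⟩

/-- The type of orbits (cycles, including fixed points) of a permutation. -/
abbrev PermOrbit (σ : Perm α) : Type _ := Quotient (Perm.SameCycle.setoid σ)

namespace PermOrbit

/-- The orbit of a point. -/
abbrev mk (σ : Perm α) (x : α) : PermOrbit σ := Quotient.mk _ x

/-- Functions on the orbits of `σ` are the `σ`-invariant functions. -/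
def invariantEquiv (σ : Perm α) (β : Type*) :
    {c : α → β // ∀ x, c (σ x) = c x} ≃ (PermOrbit σ → β) where
  toFun c := Quotient.lift c.1 fun _ _ => apply_eq_of_sameCycle c.2
  invFun g := ⟨fun x => g (mk σ x), fun x => congrArg g <|
    Quotient.sound (s := Perm.SameCycle.setoid σ) (Perm.sameCycle_apply_left.2 (.refl σ x))⟩
  left_inv _ := rfl
  right_inv _ := funext fun o => Quotient.inductionOn o fun _ => rfl

/-- The number of points of an orbit, as the period of any of its points. -/
noncomputable def length [Finite α] (o : PermOrbit σ) : ℕ :=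
  invariantEquiv σ ℕ ⟨minimalPeriod σ,
    fun x => Function.minimalPeriod_apply (σ.injective.mem_periodicPts x)⟩ o

variable [Fintype α] (σ)

open Classical in
theorem card_filter_mk_eq (o : PermOrbit σ) : #{x | mk σ x = o} = o.length := by
  induction o using Quotient.inductionOn with | _ x
  have hfiber : ({y | mk σ y = mk σ x} : Finset α) = ({y | σ.SameCycle x y} : Finset α) := by
    ext y
    simp only [mem_filter_univ, Quotient.eq]
    exact Perm.sameCycle_comm
  refine (congrArg card hfiber).trans (minimalPeriod_eq_card_of_isCycleOn ?_ ?_).symm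
  · simpa using isCycleOn_setOf_sameCycle σ x
  · simpa using Perm.SameCycle.refl σ x

open Classical in
theorem sum_mk (g : PermOrbit σ → ℕ) : ∑ x, g (mk σ x) = ∑ o : PermOrbit σ, o.length * g o := by
  rw [← sum_fiberwise univ (mk σ)]
  refine sum_congr rfl fun o _ => ?_
  rw [sum_congr rfl fun x hx => congrArg g (mem_filter.1 hx).2, sum_const, card_filter_mk_eq,
    smul_eq_mul]

open Classical in
theorem sum_mk_of_minimalPeriod_eq (g : PermOrbit σ → ℕ) (i : ℕ) :
    ∑ x with minimalPeriod σ x = i, g (mk σ x) =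
      i * ∑ o : PermOrbit σ with o.length = i, g o := by
  rw [sum_filter, sum_filter, mul_sum]
  refine (sum_mk σ fun o => if o.length = i then g o else 0).trans (sum_congr rfl fun o _ => ?_)
  split_ifs with h
  · rw [h]
  · simp

open Classical in
theorem card_filter_minimalPeriod_eq_mul_card (i : ℕ) :
    #{x | minimalPeriod σ x = i} = i * #{o : PermOrbit σ | o.length = i} := by
  simpa using sum_mk_of_minimalPeriod_eq σ (fun _ => 1) i

end PermOrbit

end Orbits

section CountingFunctions

theorem card_nat_fun_sum_fiber_eq {O ι : Type*} [Fintype O] [DecidableEq ι] {ℓ : O → ι}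
    {I : Finset ι} (hℓ : ∀ o, ℓ o ∈ I) (m : ι → ℕ) :
    Nat.card {g : O → ℕ // ∀ i ∈ I, ∑ o with ℓ o = i, g o = m i} =
      ∏ i ∈ I, Nat.multichoose #{o | ℓ o = i} (m i) := by
  classical
  let e : {g : O → ℕ // ∀ i ∈ I, ∑ o with ℓ o = i, g o = m i} ≃
      ∀ i : I, {h : {o // ℓ o = i} → ℕ // ∑ o, h o = m i} :=
    { toFun g i := ⟨fun o => g.1 o, by
        rw [← g.2 i i.2]
        exact (sum_subtype _ (by simp) _).symm⟩
      invFun h := ⟨fun o => (h ⟨ℓ o, hℓ o⟩).1 ⟨o, rfl⟩, fun i hi => by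
        rw [← (h ⟨i, hi⟩).2, sum_subtype (p := fun o => ℓ o = i) _ (by simp)]
        refine sum_congr rfl ?_
        rintro ⟨o, rfl⟩ -
        rfl⟩
      left_inv _ := rfl
      right_inv h := by
        refine funext fun ⟨i, hi⟩ => Subtype.ext (funext ?_)
        rintro ⟨o, (rfl : ℓ o = i)⟩
        rfl }
  rw [Nat.card_congr e, Nat.card_pi, ← prod_coe_sort I]
  refine prod_congr rfl fun i _ => ?_
  rw [← Nat.card_congr (Sym.equivNatSumOfFintype _ _), Nat.card_eq_fintype_card,
    Sym.card_sym_eq_multichoose, Fintype.card_subtype]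

open Classical in
theorem card_invariant_sum_eq {α : Type*} [Fintype α] (σ : Perm α) {I : Finset ℕ} (hI : 0 ∉ I)
    (hσ : ∀ x, minimalPeriod σ x ∈ I) (m : ℕ → ℕ) :
    Nat.card {c : α → ℕ // (∀ x, c (σ x) = c x) ∧
        ∀ i ∈ I, ∑ x with minimalPeriod σ x = i, c x = i * m i} =
      ∏ i ∈ I, Nat.multichoose #{o : PermOrbit σ | o.length = i} (m i) := by
  rw [← card_nat_fun_sum_fiber_eq (fun o => Quotient.inductionOn o hσ),
    ← Nat.card_congr (Equiv.subtypeSubtypeEquivSubtypeInter (fun c : α → ℕ => ∀ x, c (σ x) = c x)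
      fun c => ∀ i ∈ I, ∑ x with minimalPeriod σ x = i, c x = i * m i)]
  refine Nat.card_congr ((PermOrbit.invariantEquiv σ ℕ).subtypeEquiv fun c =>
    forall₂_congr fun i hi => ?_)
  have hi0 : 0 < i := Nat.pos_of_ne_zero (ne_of_mem_of_not_mem hi hI)
  refine Iff.trans ?_ (Nat.mul_right_inj hi0.ne')
  rw [← PermOrbit.sum_mk_of_minimalPeriod_eq]
  rfl

end CountingFunctions

section SortedLabellings

/-- The labelling `s` of the points of a linear order sorts them according to `π`: the labels
weakly increase, and `π` increases on each block of points with the same label. -/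
def IsSortedLabelling {α β : Type*} [LinearOrder β] [LinearOrder α] (π : β → β) (s : β → α) :
    Prop :=
  StrictMono fun x => toLex (s x, π x)

namespace IsSortedLabelling

variable {α β : Type*} [LinearOrder β] [LinearOrder α] {π : β → β} {s : β → α}

theorem apply_lt_apply (h : IsSortedLabelling π s) {x y : β} (hs : s x = s y) (hxy : x < y) :
    π x < π y :=
  ((Prod.Lex.toLex_lt_toLex.1 (h hxy)).resolve_left hs.not_lt).2

theorem apply_lt_apply_iff (h : IsSortedLabelling π s) {x y : β} (hs : s x = s y) :
    π x < π y ↔ x < y := by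
  refine ⟨fun hπ => ?_, h.apply_lt_apply hs⟩
  exact StrictMono.lt_iff_lt h |>.1 (Prod.Lex.toLex_lt_toLex.2 (Or.inr ⟨hs, hπ⟩))

theorem label_monotone (h : IsSortedLabelling π s) : Monotone s :=
  Prod.Lex.monotone_fst_ofLex.comp (StrictMono.monotone h)

end IsSortedLabelling

end SortedLabellings

section Descents

theorem card_strictMono_fin (n N : ℕ) :
    Nat.card {g : Fin n → Fin N // StrictMono g} = N.choose n := by
  let e : {g : Fin n → Fin N // StrictMono g} ≃ (Fin n ↪o Fin N) :=
    { toFun g := OrderEmbedding.ofStrictMono g.1 g.2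
      invFun f := ⟨f, f.strictMono⟩ }
  rw [Nat.card_congr (e.trans Set.powersetCard.ofFinEmbEquiv), Set.powersetCard.card, Nat.card_fin]

theorem card_strictMono_add {k : ℕ} {h : Fin (k + 1) → ℕ} (h_zero : h 0 = 0) (h_mono : Monotone h)
    (h_step : ∀ i : Fin k, h i.succ ≤ h i.castSucc + 1) (a : ℕ) :
    Nat.card {s : Fin (k + 1) → Fin a // StrictMono fun x => (s x : ℕ) + h x} =
      (a + h (Fin.last k)).choose (k + 1) := by
  have h_le : ∀ x, h x ≤ h (Fin.last k) := fun x => h_mono (Fin.le_last x)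
  have diff_mono : ∀ g : Fin (k + 1) → Fin (a + h (Fin.last k)), StrictMono g →
      Monotone fun x => ((g x : ℕ) : ℤ) - h x := fun g hg => by
    refine Fin.monotone_iff_le_succ.2 fun i => ?_
    have hlt : (g i.castSucc : ℕ) < g i.succ := hg Fin.castSucc_lt_succ
    have := h_step i
    omega
  have diff_mem : ∀ g : Fin (k + 1) → Fin (a + h (Fin.last k)), StrictMono g →
      ∀ x, h x ≤ g x ∧ (g x : ℕ) - h x < a := fun g hg x => by
    have hfirst := diff_mono g hg (Fin.zero_le x)
    have hlast := diff_mono g hg (Fin.le_last x)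
    have := (g (Fin.last k)).isLt
    simp only [h_zero] at hfirst hlast
    omega
  rw [← card_strictMono_fin]
  exact Nat.card_congr
    { toFun s := ⟨fun x => ⟨s.1 x + h x, add_lt_add_of_lt_of_le (s.1 x).isLt (h_le x)⟩, s.2⟩
      invFun g := ⟨fun x => ⟨g.1 x - h x, (diff_mem g.1 g.2 x).2⟩, fun x y hxy => by
        simpa [Nat.sub_add_cancel (diff_mem g.1 g.2 _).1] using g.2 hxy⟩
      left_inv s := by simp
      right_inv g := by simp [Nat.sub_add_cancel (diff_mem g.1 g.2 _).1] }

variable {k : ℕ} (π : Perm (Fin (k + 1)))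

theorem castSucc_mem_descentSet_iff {i : Fin k} :
    i.castSucc ∈ descentSet π ↔ π i.succ < π i.castSucc := by
  simp [descentSet, Fin.succ]

theorem descentNumber_eq_card : descentNumber π = #{i : Fin k | π i.succ < π i.castSucc} := by
  have hmap : descentSet π = ({i : Fin k | π i.succ < π i.castSucc} : Finset _).map
      Fin.castSuccEmb := by
    ext x
    induction x using Fin.lastCases with
    | last => simp [descentSet]
    | cast i => simp [castSucc_mem_descentSet_iff]
  rw [descentNumber, hmap, card_map]

theorem card_ascents : #{i : Fin k | π i.castSucc < π i.succ} = k - descentNumber π := by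
  have hne : ∀ i : Fin k, π i.castSucc ≠ π i.succ := fun i =>
    π.injective.ne Fin.castSucc_lt_succ.ne
  have hcompl := card_filter_add_card_filter_not (s := univ)
    fun i : Fin k => π i.succ < π i.castSucc
  simp only [not_lt, (hne _).le_iff_lt, ← descentNumber_eq_card, card_univ, Fintype.card_fin]
    at hcompl
  omega

theorem descentNumber_le : descentNumber π ≤ k := by
  simpa [descentNumber_eq_card] using card_filter_le univ fun i : Fin k => π i.succ < π i.castSucc

/-- The number of ascents of `π` among the positions before `x`. -/
def ascentsBefore : Fin (k + 1) → ℕ :=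
  Fin.partialSum fun i => if π i.castSucc < π i.succ then 1 else 0

theorem ascentsBefore_succ (i : Fin k) :
    ascentsBefore π i.succ =
      ascentsBefore π i.castSucc + if π i.castSucc < π i.succ then 1 else 0 :=
  Fin.partialSum_succ _ _

theorem ascentsBefore_last : ascentsBefore π (Fin.last k) = k - descentNumber π := by
  rw [← card_ascents, card_filter, ascentsBefore, Fin.partialSum, Fin.val_last,
    List.take_of_length_le (by simp), List.sum_ofFn]

-- Raising the labels by one at each ascent turns the sortedness condition into strict monotonicity.
theorem isSortedLabelling_iff_strictMono_add_ascentsBefore {a : ℕ} {s : Fin (k + 1) → Fin a} :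
    IsSortedLabelling π s ↔ StrictMono fun x => (s x : ℕ) + ascentsBefore π x := by
  rw [IsSortedLabelling, Fin.strictMono_iff_lt_succ, Fin.strictMono_iff_lt_succ]
  refine forall_congr' fun i => ?_
  rw [ascentsBefore_succ, Prod.Lex.toLex_lt_toLex]
  simp only [Fin.lt_def, Fin.ext_iff]
  split_ifs <;> omega

theorem card_isSortedLabelling (a : ℕ) :
    Nat.card {s : Fin (k + 1) → Fin a // IsSortedLabelling π s} =
      (a + (k - descentNumber π)).choose (k + 1) := by
  simp only [isSortedLabelling_iff_strictMono_add_ascentsBefore, ← ascentsBefore_last]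
  refine card_strictMono_add (h := ascentsBefore π) (Fin.partialSum_zero _)
    (Fin.monotone_iff_le_succ.2 fun i => ?_) (fun i => ?_) a
  all_goals
    rw [ascentsBefore_succ]
    split_ifs <;> omega

end Descents

section Words

variable {α : Type*}

/-- The shift on infinite words, which forgets the first letter. -/
def wordShift (w : Lex (ℕ → α)) : Lex (ℕ → α) := toLex fun k => ofLex w (k + 1)

theorem wordShift_iterate (j : ℕ) (w : Lex (ℕ → α)) :
    wordShift^[j] w = toLex fun k => ofLex w (k + j) := by
  induction j with
  | zero => rfl
  | succ j ih =>
    rw [Function.iterate_succ_apply', ih]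
    exact congrArg toLex (funext fun k => congrArg (ofLex w) (by omega))

theorem isPeriodicPt_wordShift_iff {i : ℕ} {w : Lex (ℕ → α)} :
    IsPeriodicPt wordShift i w ↔ Function.Periodic (ofLex w) i := by
  rw [IsPeriodicPt, Function.IsFixedPt, wordShift_iterate]
  exact funext_iff

theorem isSortedLabelling_wordShift [LinearOrder α] :
    IsSortedLabelling wordShift fun w : Lex (ℕ → α) => ofLex w 0 := by
  rintro v w ⟨i, heq, hlt⟩
  rw [Prod.Lex.toLex_lt_toLex]
  cases i with
  | zero => exact Or.inl hlt
  | succ i => exact Or.inr ⟨heq 0 i.succ_pos, i, fun j hj => heq (j + 1) (Nat.succ_lt_succ hj), hlt⟩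

/-- A word of period `i` is determined by its first `i` letters, which are arbitrary. -/
def periodicWordEquiv (α : Type*) {i : ℕ} (hi : 0 < i) :
    {w : Lex (ℕ → α) // IsPeriodicPt wordShift i w} ≃ (Fin i → α) where
  toFun w k := ofLex w.1 k
  invFun g := ⟨toLex fun k => g ⟨k % i, Nat.mod_lt _ hi⟩, by
    simp [isPeriodicPt_wordShift_iff, Function.Periodic]⟩
  left_inv w := Subtype.ext (funext (isPeriodicPt_wordShift_iff.1 w.2).map_mod_nat)
  right_inv g := by
    ext k
    simp [Nat.mod_eq_of_lt k.2]

theorem finite_isPeriodicPt_wordShift [Finite α] {i : ℕ} (hi : 0 < i) :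
    Finite {w : Lex (ℕ → α) // IsPeriodicPt wordShift i w} :=
  Finite.of_equiv _ (periodicWordEquiv α hi).symm

theorem card_isPeriodicPt_wordShift [Finite α] {i : ℕ} (hi : 0 < i) :
    Nat.card {w : Lex (ℕ → α) // IsPeriodicPt wordShift i w} = Nat.card α ^ i := by
  rw [Nat.card_congr (periodicWordEquiv α hi), Nat.card_fun, Nat.card_fin]

theorem sum_card_minimalPeriod_wordShift_eq [Finite α] {i : ℕ} (hi : 0 < i) :
    ∑ d ∈ i.divisors, Nat.card {w : Lex (ℕ → α) // minimalPeriod wordShift w = d} =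
      Nat.card α ^ i := by
  have := finite_isPeriodicPt_wordShift (α := α) hi
  let period : {w : Lex (ℕ → α) // IsPeriodicPt wordShift i w} → i.divisors := fun w =>
    ⟨minimalPeriod wordShift w.1, Nat.mem_divisors.2 ⟨w.2.minimalPeriod_dvd, hi.ne'⟩⟩
  rw [← card_isPeriodicPt_wordShift hi, Nat.card_congr (Equiv.sigmaFiberEquiv period).symm,
    Nat.card_sigma, ← sum_coe_sort i.divisors]
  refine sum_congr rfl fun d _ => Nat.card_congr
    { toFun w := ⟨⟨w.1, Function.isPeriodicPt_iff_minimalPeriod_dvd.2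
        (w.2.dvd.trans (Nat.dvd_of_mem_divisors d.2))⟩, Subtype.ext w.2⟩
      invFun w := ⟨w.1.1, congrArg Subtype.val w.2⟩ }

theorem card_minimalPeriod_wordShift_eq [Finite α] {i : ℕ} (hi : 0 < i) :
    (Nat.card {w : Lex (ℕ → α) // minimalPeriod wordShift w = i} : ℚ) =
      i * necklaceNumber i (Nat.card α) := by
  have hsum : ∀ i > 0, ∑ d ∈ i.divisors,
      (Nat.card {w : Lex (ℕ → α) // minimalPeriod wordShift w = d} : ℚ) = (Nat.card α : ℚ) ^ i :=
    fun i hi => by exact_mod_cast sum_card_minimalPeriod_wordShift_eq hi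
  rw [← ArithmeticFunction.sum_eq_iff_sum_mul_moebius_eq.1 hsum i hi, necklaceNumber, ← mul_assoc,
    mul_one_div_cancel (Nat.cast_ne_zero.2 hi.ne'), one_mul,
    Nat.sum_divisorsAntidiagonal fun d e =>
      ((ArithmeticFunction.moebius d : ℤ) : ℚ) * (Nat.card α : ℚ) ^ e]
  simp

end Words

section PeriodicWords

/-- The infinite words with least period between `1` and `n`, ordered lexicographically. A word of
least period `i` stands for a primitive word of length `i`, and the shift for its rotation. -/
abbrev PeriodicWord (α : Type*) (n : ℕ) : Type _ :=
  {w : Lex (ℕ → α) // minimalPeriod wordShift w ∈ Icc 1 n}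

namespace PeriodicWord

variable {α : Type*} {n : ℕ}

theorem mem_periodicPts (w : PeriodicWord α n) : w.1 ∈ Function.periodicPts wordShift :=
  Function.minimalPeriod_pos_iff_mem_periodicPts.1 (mem_Icc.1 w.2).1

variable [Finite α]

instance : Finite (PeriodicWord α n) := by
  have hfin : ∀ i : Icc 1 n, Finite {w : Lex (ℕ → α) // IsPeriodicPt wordShift i w} := fun i =>
    finite_isPeriodicPt_wordShift (mem_Icc.1 i.2).1
  let withPeriod : PeriodicWord α n →
      Σ i : Icc 1 n, {w : Lex (ℕ → α) // IsPeriodicPt wordShift i w} :=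
    fun w => ⟨⟨_, w.2⟩, ⟨w.1, Function.isPeriodicPt_minimalPeriod _ _⟩⟩
  exact Finite.of_injective withPeriod fun v w h =>
    Subtype.ext (congrArg (fun p => p.2.1) h)

noncomputable instance : Fintype (PeriodicWord α n) := Fintype.ofFinite _

variable (α n) in
/-- The shift as a permutation of the periodic words. -/
noncomputable def shift : Perm (PeriodicWord α n) :=
  Equiv.ofBijective
    (fun w => ⟨wordShift w.1, by rw [Function.minimalPeriod_apply w.mem_periodicPts]; exact w.2⟩)
    (Finite.injective_iff_bijective.1 fun v w h => Subtype.ext <|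
      (Function.bijOn_periodicPts wordShift).injOn v.mem_periodicPts w.mem_periodicPts
        (congrArg Subtype.val h))

theorem minimalPeriod_shift (w : PeriodicWord α n) :
    minimalPeriod (shift α n) w = minimalPeriod wordShift w.1 :=
  (minimalPeriod_eq_of_semiconj (φ := Subtype.val) (fun _ => rfl) fun _ h => Subtype.ext h).symm

theorem minimalPeriod_shift_mem (w : PeriodicWord α n) :
    minimalPeriod (shift α n) w ∈ Icc 1 n :=
  w.minimalPeriod_shift ▸ w.2

theorem isSortedLabelling_shift [LinearOrder α] :
    IsSortedLabelling (shift α n) fun w => ofLex w.1 0 := fun _ _ hvw => by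
  have hlex := Prod.Lex.toLex_lt_toLex.1 (isSortedLabelling_wordShift hvw)
  exact Prod.Lex.toLex_lt_toLex.2 hlex

open Classical in
theorem card_permOrbit_shift {i : ℕ} (hi : i ∈ Icc 1 n) :
    (#{o : PermOrbit (shift α n) | o.length = i} : ℚ) = necklaceNumber i (Nat.card α) := by
  have hi0 : 0 < i := (mem_Icc.1 hi).1
  have hcard : #{w | minimalPeriod (shift α n) w = i} =
      Nat.card {w : Lex (ℕ → α) // minimalPeriod wordShift w = i} := by
    rw [← Fintype.card_subtype, ← Nat.card_eq_fintype_card]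
    exact Nat.card_congr
      { toFun w := ⟨w.1.1, w.1.minimalPeriod_shift.symm.trans w.2⟩
        invFun w := ⟨⟨w.1, w.2.symm ▸ hi⟩, (minimalPeriod_shift _).trans w.2⟩ }
  refine mul_left_cancel₀ (Nat.cast_ne_zero.2 hi0.ne' : (i : ℚ) ≠ 0) ?_
  rw [← card_minimalPeriod_wordShift_eq hi0, ← hcard,
    PermOrbit.card_filter_minimalPeriod_eq_mul_card, Nat.cast_mul]

end PeriodicWord

end PeriodicWords

section OrbitWords

variable {α β γ : Type*}

/-- The word read off from the labels `s` along the forward orbit of `x` under `π`. -/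
def orbitWord (π : β → β) (s : β → α) (x : β) : Lex (ℕ → α) :=
  toLex fun k => s (π^[k] x)

theorem semiconj_orbitWord (π : β → β) (s : β → α) :
    Function.Semiconj (orbitWord π s) π wordShift := fun _ => rfl

theorem orbitWord_comp_of_semiconj {π : β → β} {ρ : γ → γ} {φ : γ → β}
    (h : Function.Semiconj φ ρ π) (s : β → α) (x : γ) :
    orbitWord ρ (s ∘ φ) x = orbitWord π s (φ x) :=
  congrArg toLex (funext fun k => congrArg s (h.iterate_right k x))

theorem PeriodicWord.orbitWord_shift [Finite α] {n : ℕ} (w : PeriodicWord α n) :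
    orbitWord (shift α n) (fun v => ofLex v.1 0) w = w.1 := by
  refine (orbitWord_comp_of_semiconj (φ := Subtype.val) (π := wordShift) (fun _ => rfl)
    (fun v => ofLex v 0) w).trans (funext fun k => ?_)
  simp [orbitWord, wordShift_iterate]

end OrbitWords

namespace IsSortedLabelling

variable {α β : Type*} [LinearOrder β] [LinearOrder α] {π : β → β} {s : β → α}

theorem iterate_lt_iterate (h : IsSortedLabelling π s) {x y : β} (hxy : x < y) (k : ℕ)
    (hk : ∀ j < k, s (π^[j] x) = s (π^[j] y)) : π^[k] x < π^[k] y := by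
  induction k with
  | zero => exact hxy
  | succ k ih =>
    rw [Function.iterate_succ_apply', Function.iterate_succ_apply']
    exact h.apply_lt_apply (hk k k.lt_succ_self) (ih fun j hj => hk j (hj.trans k.lt_succ_self))

theorem orbitWord_monotone (h : IsSortedLabelling π s) : Monotone (orbitWord π s) := by
  refine monotone_iff_forall_lt.2 fun x y hxy => ?_
  by_contra! ⟨i, heq, hlt⟩
  exact hlt.not_ge (h.label_monotone (h.iterate_lt_iterate hxy i fun j hj => (heq j hj).symm).le)

-- If `π^[k] x ≠ x` had the same word as `x`, then `x, π^[k] x, π^[2k] x, …` would be strictly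
-- monotone.
theorem iterate_eq_of_orbitWord_eq [Finite β] (h : IsSortedLabelling π s) {x : β} {k : ℕ}
    (hword : orbitWord π s (π^[k] x) = orbitWord π s x) : π^[k] x = x := by
  have hlabel : ∀ j, s (π^[j] (π^[k] x)) = s (π^[j] x) := congrFun hword
  have hsucc : ∀ j, π^[k * (j + 1)] x = π^[k * j] (π^[k] x) := fun j => by
    rw [← Function.iterate_add_apply, Nat.mul_succ]
  by_contra hne
  rcases lt_or_gt_of_ne hne with hlt | hgt
  · refine not_injective_infinite_finite (fun j => π^[k * j] x)
      (strictAnti_nat_of_succ_lt fun j => ?_).injective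
    rw [hsucc]
    exact h.iterate_lt_iterate hlt _ fun j _ => hlabel j
  · refine not_injective_infinite_finite (fun j => π^[k * j] x)
      (strictMono_nat_of_lt_succ fun j => ?_).injective
    rw [hsucc]
    exact h.iterate_lt_iterate hgt _ fun j _ => (hlabel j).symm

theorem minimalPeriod_orbitWord [Finite β] (h : IsSortedLabelling π s) (x : β) :
    minimalPeriod wordShift (orbitWord π s x) = minimalPeriod π x :=
  minimalPeriod_eq_of_semiconj (semiconj_orbitWord π s) fun _ => h.iterate_eq_of_orbitWord_eq

end IsSortedLabelling

section Multiplicity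

variable {n : ℕ} {α : Type*} [LinearOrder α]

namespace IsSortedLabelling

variable {π ρ : Perm (Fin n)} {s r : Fin n → α}

/-- The word along the orbit of a point, as a periodic word of period at most `n`. -/
def periodicOrbitWord (h : IsSortedLabelling π s) (x : Fin n) : PeriodicWord α n :=
  ⟨orbitWord π s x, by
    rw [h.minimalPeriod_orbitWord, mem_Icc]
    exact ⟨minimalPeriod_perm_pos π x, by
      simpa using Function.minimalPeriod_le_card (f := π) (x := x)⟩⟩

theorem periodicOrbitWord_monotone (h : IsSortedLabelling π s) : Monotone h.periodicOrbitWord :=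
  h.orbitWord_monotone

theorem label_eq_of_periodicOrbitWord_eq (h : IsSortedLabelling π s) (h' : IsSortedLabelling ρ r)
    {x y : Fin n} (hxy : h.periodicOrbitWord x = h'.periodicOrbitWord y) : s x = r y :=
  congrFun (congrArg Subtype.val hxy) 0

/-- The number of points whose orbit spells the word `w`. -/
noncomputable def wordMultiplicity (h : IsSortedLabelling π s) (w : PeriodicWord α n) : ℕ :=
  #{x | h.periodicOrbitWord x = w}

variable [Finite α]

theorem periodicOrbitWord_apply (h : IsSortedLabelling π s) (x : Fin n) :
    h.periodicOrbitWord (π x) = PeriodicWord.shift α n (h.periodicOrbitWord x) := rfl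

theorem minimalPeriod_periodicOrbitWord (h : IsSortedLabelling π s) (x : Fin n) :
    minimalPeriod (PeriodicWord.shift α n) (h.periodicOrbitWord x) = minimalPeriod π x :=
  (PeriodicWord.minimalPeriod_shift _).trans (h.minimalPeriod_orbitWord x)

theorem wordMultiplicity_shift (h : IsSortedLabelling π s) (w : PeriodicWord α n) :
    h.wordMultiplicity (PeriodicWord.shift α n w) = h.wordMultiplicity w := by
  refine (card_equiv π fun x => ?_).symm
  simp [periodicOrbitWord_apply]

theorem sum_wordMultiplicity (h : IsSortedLabelling π s) (i : ℕ) :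
    ∑ w with minimalPeriod (PeriodicWord.shift α n) w = i, h.wordMultiplicity w =
      #{x | minimalPeriod π x = i} := by
  rw [card_eq_sum_card_fiberwise (f := h.periodicOrbitWord)
    (t := {w | minimalPeriod (PeriodicWord.shift α n) w = i})
    fun x hx => by simpa [minimalPeriod_periodicOrbitWord] using hx]
  refine sum_congr rfl fun w hw => congrArg card ?_
  rw [filter_filter]
  refine filter_congr fun x _ => (and_iff_right_of_imp ?_).symm
  rintro rfl
  rw [← h.minimalPeriod_periodicOrbitWord]
  exact (mem_filter.1 hw).2

theorem apply_lt_apply_iff_periodicOrbitWord (h : IsSortedLabelling π s) {x y : Fin n} :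
    π x < π y ↔
      PeriodicWord.shift α n (h.periodicOrbitWord x) <
        PeriodicWord.shift α n (h.periodicOrbitWord y) ∨
      h.periodicOrbitWord x = h.periodicOrbitWord y ∧ x < y := by
  simp only [← periodicOrbitWord_apply]
  constructor
  · intro hπ
    rcases (h.periodicOrbitWord_monotone hπ.le).lt_or_eq with hlt | heq
    · exact Or.inl hlt
    · have hword : h.periodicOrbitWord x = h.periodicOrbitWord y :=
        (PeriodicWord.shift α n).injective heq
      have hlabel : s x = s y := h.label_eq_of_periodicOrbitWord_eq h hword
      exact Or.inr ⟨hword, (h.apply_lt_apply_iff hlabel).1 hπ⟩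
  · rintro (hlt | ⟨hword, hxy⟩)
    · exact h.periodicOrbitWord_monotone.reflect_lt hlt
    · exact h.apply_lt_apply (h.label_eq_of_periodicOrbitWord_eq h hword) hxy

end IsSortedLabelling

theorem equiv_eq_of_lt_iff_lt {β γ : Type*} [LinearOrder β] [WellFoundedLT β] {e f : γ ≃ β}
    (h : ∀ x y, e x < e y ↔ f x < f y) : e = f := by
  let g : β ≃o β :=
    { e.symm.trans f with
      map_rel_iff' := by
        intro a b
        have hle := not_congr (h (e.symm b) (e.symm a))
        simpa using hle.symm }
  refine Equiv.ext fun x => ?_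
  have hg : g (e x) = e x := DFunLike.congr_fun (Subsingleton.elim g (OrderIso.refl β)) (e x)
  simpa [g] using hg.symm

theorem eq_of_monotone_of_card_fiber_eq {X : Type*} [LinearOrder X] {V W : Fin n → X}
    (hV : Monotone V) (hW : Monotone W) (h : ∀ w, #{x | V x = w} = #{x | W x = w}) : V = W := by
  let fiberEquiv (w : X) : {x // V x = w} ≃ {x // W x = w} :=
    Fintype.equivOfCardEq (by rw [Fintype.card_subtype, Fintype.card_subtype, h])
  let e : Perm (Fin n) := (Equiv.sigmaFiberEquiv V).symm.trans
    ((Equiv.sigmaCongrRight fiberEquiv).trans (Equiv.sigmaFiberEquiv W))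
  have he : W ∘ e = V := funext fun x => (fiberEquiv (V x) ⟨x, rfl⟩).2
  calc V = W ∘ e := he.symm
    _ = W ∘ (1 : Perm (Fin n)) := Tuple.unique_monotone (he.symm ▸ hV) hW
    _ = W := rfl

namespace IsSortedLabelling

variable {π ρ : Perm (Fin n)} {s r : Fin n → α} [Finite α]

theorem eq_and_eq_of_wordMultiplicity_eq (h : IsSortedLabelling π s) (h' : IsSortedLabelling ρ r)
    (hmul : h.wordMultiplicity = h'.wordMultiplicity) : π = ρ ∧ s = r := by
  have hword : h.periodicOrbitWord = h'.periodicOrbitWord :=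
    eq_of_monotone_of_card_fiber_eq h.periodicOrbitWord_monotone h'.periodicOrbitWord_monotone
      (congrFun hmul)
  refine ⟨equiv_eq_of_lt_iff_lt fun x y => ?_,
    funext fun x => h.label_eq_of_periodicOrbitWord_eq h' (congrFun hword x)⟩
  rw [h.apply_lt_apply_iff_periodicOrbitWord, h'.apply_lt_apply_iff_periodicOrbitWord, hword]

end IsSortedLabelling

end Multiplicity

section BlowUp

variable {α β γ : Type*}

/-- The linear order obtained by replacing each point `x` by `c x` consecutive copies. -/
abbrev BlowUp (c : β → ℕ) : Type _ := Σₗ x, Fin (c x)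

/-- The permutation of a blow-up along an invariant function which maps the `j`-th copy of `x` to
the `j`-th copy of `π x`. -/
def BlowUp.perm {c : β → ℕ} (π : Perm β) (hc : ∀ x, c (π x) = c x) : Perm (BlowUp c) :=
  ofLex.trans ((Equiv.sigmaCongr π fun x => finCongr (hc x).symm).trans toLex)

theorem BlowUp.fst_perm {c : β → ℕ} {π : Perm β} (hc : ∀ x, c (π x) = c x) (p : BlowUp c) :
    (ofLex (perm π hc p)).1 = π (ofLex p).1 := rfl

variable [LinearOrder β] [LinearOrder α]

theorem IsSortedLabelling.blowUp {c : β → ℕ} {π : Perm β} {s : β → α}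
    (h : IsSortedLabelling π s) (hc : ∀ x, c (π x) = c x) :
    IsSortedLabelling (BlowUp.perm π hc) fun p => s (ofLex p).1 := by
  intro p q hpq
  rw [Prod.Lex.toLex_lt_toLex]
  rcases hpq with @⟨x, y, i, j, hxy⟩ | @⟨x, i, j, hij⟩
  · refine (Prod.Lex.toLex_lt_toLex.1 (h hxy)).imp_right fun hπ => ⟨hπ.1, ?_⟩
    exact Sigma.Lex.left _ _ hπ.2
  · exact Or.inr ⟨rfl, Sigma.Lex.right _ _ hij⟩

theorem IsSortedLabelling.conj [LinearOrder γ] {π : β → β} {s : β → α}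
    (h : IsSortedLabelling π s) (e : γ ≃o β) : IsSortedLabelling (e.symm ∘ π ∘ e) (s ∘ e) :=
  fun x y hxy => by simpa [Prod.Lex.toLex_lt_toLex] using h (e.strictMono hxy)

theorem exists_wordMultiplicity_eq [Finite α] {n : ℕ} {c : PeriodicWord α n → ℕ}
    (hc : ∀ w, c (PeriodicWord.shift α n w) = c w) (hsum : ∑ w, c w = n) :
    ∃ (π : Perm (Fin n)) (s : Fin n → α) (h : IsSortedLabelling π s), h.wordMultiplicity = c := by
  have hcard : Fintype.card (BlowUp c) = n := by
    simpa [Fintype.card_lex] using hsum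
  let e : Fin n ≃o BlowUp c := Fintype.orderIsoFinOfCardEq _ hcard
  let base (x : Fin n) : PeriodicWord α n := (ofLex (e x)).1
  let π : Perm (Fin n) := e.toEquiv.trans ((BlowUp.perm _ hc).trans e.symm.toEquiv)
  have hπ : IsSortedLabelling π fun x => ofLex (base x).1 0 :=
    (PeriodicWord.isSortedLabelling_shift.blowUp hc).conj e
  have hbase : Function.Semiconj base π (PeriodicWord.shift α n) := fun x => by
    simp [base, π, BlowUp.fst_perm]
  have hword : ∀ x, hπ.periodicOrbitWord x = base x := fun x => Subtype.ext <|
    (orbitWord_comp_of_semiconj hbase _ x).trans (PeriodicWord.orbitWord_shift _)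
  refine ⟨π, _, hπ, funext fun w => ?_⟩
  calc #{x | hπ.periodicOrbitWord x = w}
      = #{p : BlowUp c | (ofLex p).1 = w} :=
        card_equiv e.toEquiv fun x => by
          simp only [mem_filter, mem_univ, true_and, hword]
          rfl
    _ = Fintype.card (Fin (c w)) := by
      rw [← Fintype.card_subtype]
      exact Fintype.card_congr (Equiv.sigmaSubtype w)
    _ = c w := Fintype.card_fin _

end BlowUp

section SortedLabellingsOfCycleType

variable {n : ℕ} {α : Type*} [LinearOrder α] [Finite α] {m : ℕ → ℕ}

theorem card_isSortedLabelling_eq_card_invariant (hm : ∑ i ∈ Icc 1 n, i * m i = n) :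
    Nat.card {p : Perm (Fin n) × (Fin n → α) // IsSortedLabelling p.1 p.2 ∧
        ∀ i ∈ Icc 1 n, #{x | minimalPeriod p.1 x = i} = i * m i} =
      Nat.card {c : PeriodicWord α n → ℕ // (∀ w, c (PeriodicWord.shift α n w) = c w) ∧
        ∀ i ∈ Icc 1 n, ∑ w with minimalPeriod (PeriodicWord.shift α n) w = i, c w = i * m i} := by
  refine Nat.card_eq_of_bijective (fun p => ⟨p.2.1.wordMultiplicity,
    p.2.1.wordMultiplicity_shift, fun i hi => ?_⟩) ⟨?_, ?_⟩
  · rw [p.2.1.sum_wordMultiplicity, p.2.2 i hi]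
  · intro p q hpq
    obtain ⟨hπ, hs⟩ := p.2.1.eq_and_eq_of_wordMultiplicity_eq q.2.1 (congrArg Subtype.val hpq)
    exact Subtype.ext (Prod.ext hπ hs)
  · rintro ⟨c, hc, hsum⟩
    have hn : ∑ w, c w = n := by
      rw [← sum_fiberwise_of_maps_to (t := Icc 1 n)
        (g := fun w => minimalPeriod (PeriodicWord.shift α n) w)
        (fun w _ => w.minimalPeriod_shift_mem), sum_congr rfl hsum, hm]
    obtain ⟨π, s, h, rfl⟩ := exists_wordMultiplicity_eq hc hn
    exact ⟨⟨(π, s), h, fun i hi => by rw [← h.sum_wordMultiplicity, hsum i hi]⟩, rfl⟩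

theorem choose_natCast_add_sub_one {R : Type*} [CommRing R] [BinomialRing R] (N m : ℕ) :
    Ring.choose ((N : R) + m - 1) m = Nat.multichoose N m := by
  rcases m with _ | m
  · simp
  · rw [Nat.multichoose_eq, ← Ring.choose_natCast]
    simp [← add_assoc]

theorem card_isSortedLabelling_eq_prod_choose (hm : ∑ i ∈ Icc 1 n, i * m i = n) :
    (Nat.card {p : Perm (Fin n) × (Fin n → α) // IsSortedLabelling p.1 p.2 ∧
        ∀ i ∈ Icc 1 n, #{x | minimalPeriod p.1 x = i} = i * m i} : ℚ) =
      ∏ i ∈ Icc 1 n, Ring.choose (necklaceNumber i (Nat.card α) + m i - 1) (m i) := by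
  classical
  rw [card_isSortedLabelling_eq_card_invariant hm,
    card_invariant_sum_eq _ (by simp) PeriodicWord.minimalPeriod_shift_mem, Nat.cast_prod]
  refine prod_congr rfl fun i hi => ?_
  rw [← PeriodicWord.card_permOrbit_shift hi, choose_natCast_add_sub_one]

end SortedLabellingsOfCycleType

section ConjugacyClasses

variable {n : ℕ} {lam : n.Partition} {C : ConjClasses (Perm (Fin n))}

theorem mem_Icc_of_mem_parts (p : n.Partition) {i : ℕ} (hi : i ∈ p.parts) : i ∈ Icc 1 n :=
  mem_Icc.2 ⟨p.parts_pos hi, p.le_of_mem_parts hi⟩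

theorem sum_mul_count_parts (p : n.Partition) : ∑ i ∈ Icc 1 n, i * p.parts.count i = n := by
  have hsum := sum_multiset_count_of_subset p.parts (Icc 1 n)
    fun i hi => mem_Icc_of_mem_parts p (Multiset.mem_toFinset.1 hi)
  simpa only [p.parts_sum, smul_eq_mul, mul_comm] using hsum.symm

theorem parts_eq_iff_forall_mul_count_eq (p q : n.Partition) :
    p.parts = q.parts ↔ ∀ i ∈ Icc 1 n, i * p.parts.count i = i * q.parts.count i := by
  refine ⟨fun h i _ => by rw [h], fun h => Multiset.ext.2 fun i => ?_⟩
  by_cases hi : i ∈ Icc 1 n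
  · exact Nat.eq_of_mul_eq_mul_left (mem_Icc.1 hi).1 (h i hi)
  · rw [Multiset.count_eq_zero_of_notMem fun hp => hi (mem_Icc_of_mem_parts p hp),
      Multiset.count_eq_zero_of_notMem fun hq => hi (mem_Icc_of_mem_parts q hq)]

theorem mem_carrier_iff_parts_eq (hC : ∀ π ∈ C.carrier, π.partition.parts = lam.parts)
    {π : Perm (Fin n)} : π ∈ C.carrier ↔ π.partition.parts = lam.parts := by
  refine ⟨hC π, fun h => ?_⟩
  obtain ⟨σ, rfl⟩ := ConjClasses.exists_rep C
  rw [ConjClasses.mem_carrier_iff_mk_eq, ConjClasses.mk_eq_mk_iff_isConj,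
    Perm.partition_eq_of_isConj]
  exact Nat.Partition.ext (h.trans (hC σ ConjClasses.mem_carrier_mk).symm)

theorem mem_carrier_iff_card_minimalPeriod
    (hC : ∀ π ∈ C.carrier, π.partition.parts = lam.parts) {π : Perm (Fin n)} :
    π ∈ C.carrier ↔
      ∀ i ∈ Icc 1 n, #{x | minimalPeriod π x = i} = i * lam.parts.count i := by
  obtain ⟨p, hp⟩ : ∃ p : n.Partition, p.parts = π.partition.parts :=
    ⟨⟨_, π.partition.parts_pos, by simp [π.partition.parts_sum]⟩, rfl⟩
  simp only [mem_carrier_iff_parts_eq hC, card_filter_minimalPeriod_eq_mul_count_parts, ← hp,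
    parts_eq_iff_forall_mul_count_eq]

end ConjugacyClasses

section Reciprocity

open intPolynomialFunctions

theorem necklaceNumber_mem (i : ℕ) : necklaceNumber i ∈ intPolynomialFunctions ℚ :=
  mul_mem (const_mem _) <| fun_sum_mem fun d _ =>
    mul_mem (const_mem _) (pow_mem intCast_mem (i / d))

theorem cycleBinomialProduct_mem {n : ℕ} (lam : n.Partition) :
    cycleBinomialProduct lam ∈ intPolynomialFunctions ℚ :=
  fun_prod_mem fun i _ => choose_mem
    (sub_mem (add_mem (necklaceNumber_mem i) (const_mem _)) (const_mem _)) _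

variable {k : ℕ} {lam : (k + 1).Partition} {C : ConjClasses (Perm (Fin (k + 1)))}

open Classical in
theorem cycleBinomialProduct_natCast (hC : ∀ π ∈ C.carrier, π.partition.parts = lam.parts)
    (a : ℕ) :
    cycleBinomialProduct lam a =
      ∑ π : Perm (Fin (k + 1)) with π ∈ C.carrier,
        ((a + (k - descentNumber π)).choose (k + 1) : ℚ) := by
  let e : {p : Perm (Fin (k + 1)) × (Fin (k + 1) → Fin a) // IsSortedLabelling p.1 p.2 ∧
        ∀ i ∈ Icc 1 (k + 1), #{x | minimalPeriod p.1 x = i} = i * lam.parts.count i} ≃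
      Σ π : {π : Perm (Fin (k + 1)) // π ∈ C.carrier},
        {s : Fin (k + 1) → Fin a // IsSortedLabelling π.1 s} :=
    { toFun p := ⟨⟨p.1.1, (mem_carrier_iff_card_minimalPeriod hC).2 p.2.2⟩, ⟨p.1.2, p.2.1⟩⟩
      invFun q := ⟨(q.1.1, q.2.1), q.2.2, (mem_carrier_iff_card_minimalPeriod hC).1 q.1.2⟩ }
  have hcard := card_isSortedLabelling_eq_prod_choose (α := Fin a) (sum_mul_count_parts lam)
  rw [Nat.card_congr e, Nat.card_sigma, Nat.card_fin] at hcard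
  simp only [card_isSortedLabelling] at hcard
  rw [cycleBinomialProduct, ← hcard, Nat.cast_sum]
  exact (sum_subtype {π | π ∈ C.carrier} (by simp)
    fun π => ((a + (k - descentNumber π)).choose (k + 1) : ℚ)).symm

theorem neg_one_pow_mul_choose_neg_add {R : Type*} [CommRing R] [BinomialRing R] {d k : ℕ}
    (hd : d ≤ k) (a : ℕ) :
    (-1) ^ (k + 1) * Ring.choose (-(a : R) + (k - d : ℕ)) (k + 1) =
      (a + d).choose (k + 1) := by
  have harg : -(a : R) + (k - d : ℕ) = -((a : R) + d - k) := by
    push_cast [hd]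
    ring
  have hreflect : (a : R) + d - k + (k + 1 : ℕ) - 1 = (a + d : ℕ) := by
    push_cast
    ring
  rw [harg, Ring.choose_neg, hreflect, Ring.choose_natCast, Units.smul_def, Int.negOnePow_def,
    zpow_natCast]
  simp [← mul_assoc, ← mul_pow]

open Classical in
theorem neg_one_pow_mul_cycleBinomialProduct_neg
    (hC : ∀ π ∈ C.carrier, π.partition.parts = lam.parts) (a : ℕ) :
    (-1) ^ (k + 1) * cycleBinomialProduct lam (-a) =
      ∑ π : Perm (Fin (k + 1)) with π ∈ C.carrier, ((a + descentNumber π).choose (k + 1) : ℚ) := by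
  let F (z : ℤ) : ℚ := ∑ π : Perm (Fin (k + 1)) with π ∈ C.carrier,
    Ring.choose ((z : ℚ) + (k - descentNumber π : ℕ)) (k + 1)
  have hF : F ∈ intPolynomialFunctions ℚ :=
    fun_sum_mem fun π _ => choose_mem (add_mem intCast_mem (const_mem _)) _
  have heq : cycleBinomialProduct lam = F :=
    eq_of_forall_natCast_eq (cycleBinomialProduct_mem lam) hF fun b => by
      simp only [F, cycleBinomialProduct_natCast hC, Int.cast_natCast, ← Nat.cast_add,
        Ring.choose_natCast]
  rw [heq, mul_sum]
  refine sum_congr rfl fun π _ => ?_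
  simpa using neg_one_pow_mul_choose_neg_add (R := ℚ) (descentNumber_le π) a

end Reciprocity

theorem mainTheorem3 (n : ℕ) (hn : 1 ≤ n) (lam : n.Partition)
    (C : ConjClasses (Equiv.Perm (Fin n)))
    (hC : ∀ π ∈ C.carrier, π.partition.parts = lam.parts)
    (t : ℂ) (ht : 1 < ‖t‖) :
    Summable (fun a : ℕ+ =>
      t ^ (-(a : ℤ)) * ((-1 : ℂ) ^ n * (cycleBinomialProduct lam (-(a : ℤ)) : ℂ))) ∧
    descentGenFun C.carrier t =
      (t - 1) ^ (n + 1) * ∑' a : ℕ+,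
        t ^ (-(a : ℤ)) * ((-1 : ℂ) ^ n * (cycleBinomialProduct lam (-(a : ℤ)) : ℂ)) := by
  classical
  obtain ⟨k, rfl⟩ := Nat.exists_eq_add_of_le' hn
  have ht1 : t - 1 ≠ 0 := sub_ne_zero.2 fun h => by simp [h] at ht
  have hterm (a : ℕ+) :
      t ^ (-(a : ℤ)) * ((-1 : ℂ) ^ (k + 1) * (cycleBinomialProduct lam (-(a : ℤ)) : ℂ)) =
        ∑ π : Perm (Fin (k + 1)) with π ∈ C.carrier,
          t ^ (-(a : ℤ)) * (((a : ℕ) + descentNumber π).choose (k + 1) : ℂ) := by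
    rw [← mul_sum]
    congr 1
    exact_mod_cast congrArg (Rat.cast (K := ℂ)) (neg_one_pow_mul_cycleBinomialProduct_neg hC a)
  have hseries := hasSum_sum (s := ({π | π ∈ C.carrier} : Finset (Perm (Fin (k + 1)))))
    fun π _ => hasSum_zpow_neg_mul_choose (Nat.lt_succ_of_le (descentNumber_le π)) ht
  simp only [hterm]
  refine ⟨hseries.summable, ?_⟩
  rw [hseries.tsum_eq, mul_sum, descentGenFun]
  refine sum_congr (by congr!) fun π _ => ?_
  rw [mul_div_cancel₀ _ (pow_ne_zero _ ht1)]
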